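/- Let $i,j,k$ be positive integers. Let $\Delta\subset\mathbb{R}^2$ be the triangle with vertices $(0,0),(i,0),(i,j)$ and let $L$ be the segment from $(0,0)$ to $(i,j)$. Let $C_k$ be the set of sequences $((x_l,y_l))_{1\le l\le k}$ of pairs of positive integers with $\sum_l x_l=i$, $\sum_l y_l=j$ and $\frac{y_1}{x_1}<\cdots<\frac{y_k}{x_k}$. A convex $m$-gon ($m\ge 2$) means the convex hull of finitely many points of $\mathbb{Z}^2$ that has exactly $m$ vertices (extreme points); segments count as $2$-gons, and a segment is an edge of itself. Then the map that sends $((x_l,y_l))_{1\le l\le k}$ to the convex hull $P$ of the points $(x_1+\cdots+x_m,\;y_1+\cdots+y_m)$, $0\le m\le k$, is a bijection from $C_k$ onto the set of convex $(k+1)$-gons $P\subseteq\Delta$ that have $L$ as an edge and meet the horizontal and vertical edges of $\Delta$ only in the points $(0,0)$ and $(i,j)$. Moreover, if $P$ corresponds to $((x_l,y_l))_{1\le l\le k}$, then $$\frac12\left(\sum_{1\le l_1<l_2\le k}(x_{l_1}y_{l_2}-x_{l_2}y_{l_1})+\sum_{1\le l\le k}\gcd(x_l,y_l)\right)=i(P)+b(P)-1-\frac12\gcd(i,j),$$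 where $i(P)$ and $b(P)$ are the numbers of points of $\mathbb{Z}^2$ in the interior and on the boundary of $P$, respectively (interior and boundary taken in $\mathbb{R}^2$, so that all lattice points of a $2$-gon are boundary points). -/

import Mathlib

/-- `C_k` for given `i`, `j`: sequences of `k` pairs `(x_l, y_l)` of positive integers with
`∑ x_l = i`, `∑ y_l = j` and strictly increasing slopes `y_l / x_l`. -/
def slopeSequences (i j k : ℕ) : Set (Fin k → ℕ × ℕ) :=
  {c | (∀ l, 0 < (c l).1 ∧ 0 < (c l).2) ∧ ∑ l, (c l).1 = i ∧ ∑ l, (c l).2 = j ∧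
    StrictMono fun l => ((c l).2 : ℚ) / ((c l).1 : ℚ)}

/-- The points of the plane with integer coordinates. -/
def latticePoints : Set (ℝ × ℝ) :=
  Set.range fun p : ℤ × ℤ => ((p.1 : ℝ), (p.2 : ℝ))

/-- `P` is a convex `m`-gon with lattice vertices (`2 ≤ m`, a segment being a `2`-gon): the convex
hull of its vertices (extreme points), which are exactly `m` in number and are lattice points. -/
def IsConvexLatticeGon (m : ℕ) (P : Set (ℝ × ℝ)) : Prop :=
  2 ≤ m ∧ P.extremePoints ℝ ⊆ latticePoints ∧ (P.extremePoints ℝ).ncard = m ∧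
    P = convexHull ℝ (P.extremePoints ℝ)

/-- The segment from `a` to `b` is an edge of the convex polygon `P`: it is nondegenerate and it is
the intersection of `P` with a supporting line. (A `2`-gon is an edge of itself, by means of the
zero functional or of the line that contains it.) -/
def IsEdge (P : Set (ℝ × ℝ)) (a b : ℝ × ℝ) : Prop :=
  a ≠ b ∧ IsExposed ℝ P (segment ℝ a b)

/-- The triangle `Δ` with vertices `(0,0)`, `(i,0)`, `(i,j)`. -/
def triangleDelta (i j : ℕ) : Set (ℝ × ℝ) :=
  convexHull ℝ {((0 : ℝ), (0 : ℝ)), ((i : ℝ), (0 : ℝ)), ((i : ℝ), (j : ℝ))}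

/-- The union of the horizontal and the vertical edge of `Δ`. -/
def legsDelta (i j : ℕ) : Set (ℝ × ℝ) :=
  segment ℝ ((0 : ℝ), (0 : ℝ)) ((i : ℝ), (0 : ℝ)) ∪
    segment ℝ ((i : ℝ), (0 : ℝ)) ((i : ℝ), (j : ℝ))

/-- The convex lattice `m`-gons that lie in `Δ`, have the segment `L` from `(0,0)` to `(i,j)` as an
edge, and meet the horizontal and vertical edges of `Δ` nowhere but in the endpoints of `L`. -/
def gonsInDelta (i j m : ℕ) : Set (Set (ℝ × ℝ)) :=
  {P | IsConvexLatticeGon m P ∧ P ⊆ triangleDelta i j ∧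
    P ∩ legsDelta i j ⊆ {((0 : ℝ), (0 : ℝ)), ((i : ℝ), (j : ℝ))} ∧
    IsEdge P ((0 : ℝ), (0 : ℝ)) ((i : ℝ), (j : ℝ))}

/-- The partial sum `(x_1 + ⋯ + x_m, y_1 + ⋯ + y_m)`, for `0 ≤ m ≤ k`. -/
def pathVertex {k : ℕ} (c : Fin k → ℕ × ℕ) (m : Fin (k + 1)) : ℝ × ℝ :=
  (∑ l with l.castSucc < m, ((c l).1 : ℝ), ∑ l with l.castSucc < m, ((c l).2 : ℝ))

/-- The convex polygon spanned by all the partial sums of the sequence. -/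
def pathPolygon {k : ℕ} (c : Fin k → ℕ × ℕ) : Set (ℝ × ℝ) :=
  convexHull ℝ (Set.range (pathVertex c))

/-- `i(P)`: the number of lattice points in the interior of `P`. -/
noncomputable def interiorCount (P : Set (ℝ × ℝ)) : ℕ :=
  (latticePoints ∩ interior P).ncard

/-- `b(P)`: the number of lattice points on the boundary of `P`; all of those of a `2`-gon. -/
noncomputable def boundaryCount (P : Set (ℝ × ℝ)) : ℕ :=
  (latticePoints ∩ frontier P).ncard

/-!
The partial sums of a sequence in `C_k` are the vertices of a chain running from left to right with
increasing slopes, so for each of them some functional `z ↦ s * z.1 - z.2` attains its maximum over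
the chain there and only there; thus all of them are extreme points and the sequence can be read
off the polygon. Conversely, `L` bounds a polygon of `Δ` from above, so each of its vertices is the
lowest point on its vertical line. Ordered by abscissa the vertices therefore form such a chain, and
the condition on the legs of `Δ` makes all its edges rise strictly.

The identity is Pick's theorem for convex chains. The lattice points are counted column by column as
`⌊L⌋ - ⌈lower boundary⌉ + 1`, and along a segment from `p` to `q` the half-turn about its midpoint
evaluates the sum of floors and ceilings, while floor and ceiling agree in exactly
`gcd (q.1 - p.1) (q.2 - p.2)` of the columns `p.1 < n ≤ q.1`.
-/

section Faces

variable {𝕜 E : Type*} [CommRing 𝕜] [LinearOrder 𝕜] [IsStrictOrderedRing 𝕜] [AddCommGroup E]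
  [Module 𝕜 E] {s : Set E} {f : E →ₗ[𝕜] 𝕜} {M : 𝕜} {x v : E}

theorem le_of_mem_convexHull (hM : ∀ y ∈ s, f y ≤ M) (hx : x ∈ convexHull 𝕜 s) : f x ≤ M :=
  convexHull_min hM (convex_halfSpace_le f.isLinear M) hx

theorem mem_convexHull_face (hM : ∀ y ∈ s, f y ≤ M) (hx : x ∈ convexHull 𝕜 s) (hfx : f x = M) :
    x ∈ convexHull 𝕜 {y ∈ s | f y = M} := by
  let T : Set E := {z | f z ≤ M ∧ (f z = M → z ∈ convexHull 𝕜 {y ∈ s | f y = M})}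
  have hsT : s ⊆ T := fun y hy => ⟨hM y hy, fun h => subset_convexHull 𝕜 _ ⟨hy, h⟩⟩
  have hT : Convex 𝕜 T := by
    refine convex_iff_forall_pos.2 fun y hy z hz a b ha hb hab => ?_
    have hf : f (a • y + b • z) = M - (a * (M - f y) + b * (M - f z)) := by
      simp only [map_add, map_smul, smul_eq_mul]
      linear_combination M * hab
    have hay : 0 ≤ a * (M - f y) := mul_nonneg ha.le (sub_nonneg.2 hy.1)
    have hbz : 0 ≤ b * (M - f z) := mul_nonneg hb.le (sub_nonneg.2 hz.1)
    refine ⟨by linarith, fun h => ?_⟩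
    have hay0 : a * (M - f y) = 0 := by linarith
    have hbz0 : b * (M - f z) = 0 := by linarith
    have hyM : f y = M := (sub_eq_zero.1 ((mul_eq_zero.1 hay0).resolve_left ha.ne')).symm
    have hzM : f z = M := (sub_eq_zero.1 ((mul_eq_zero.1 hbz0).resolve_left hb.ne')).symm
    exact convex_convexHull 𝕜 _ (hy.2 hyM) (hz.2 hzM) ha.le hb.le hab
  exact (convexHull_min hsT hT hx).2 hfx

theorem lt_of_mem_convexHull_of_ne (hv : ∀ y ∈ s, y ≠ v → f y < f v) (hx : x ∈ convexHull 𝕜 s)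
    (hne : x ≠ v) : f x < f v := by
  have hle : ∀ y ∈ s, f y ≤ f v := fun y hy => by
    rcases eq_or_ne y v with rfl | h
    · exact le_rfl
    · exact (hv y hy h).le
  refine (le_of_mem_convexHull hle hx).lt_of_ne fun h => hne ?_
  have hface : {y ∈ s | f y = f v} ⊆ {v} := fun y hy =>
    by_contra fun h => (hv y hy.1 h).ne hy.2
  simpa only [convexHull_singleton, Set.mem_singleton_iff] using
    convexHull_mono hface (mem_convexHull_face hle hx h)

theorem mem_extremePoints_of_forall_lt (hv : v ∈ s) (h : ∀ y ∈ s, y ≠ v → f y < f v) :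
    v ∈ s.extremePoints 𝕜 := by
  refine ⟨hv, fun y hy z hz ⟨a, b, ha, hb, hab, hyz⟩ => ?_⟩
  by_contra hne
  have hfz : f z ≤ f v := by
    rcases eq_or_ne z v with rfl | hz'
    · exact le_rfl
    · exact (h z hz hz').le
  have hlt : a * f y + b * f z < a * f v + b * f v :=
    add_lt_add_of_lt_of_le (mul_lt_mul_of_pos_left (h y hy hne) ha)
      (mul_le_mul_of_nonneg_left hfz hb.le)
  have hfv : a * f y + b * f z = f v := by
    rw [← hyz, map_add, map_smul, map_smul, smul_eq_mul, smul_eq_mul]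
  rw [← add_mul, hab, one_mul, hfv] at hlt
  exact lt_irrefl _ hlt

theorem isExposed_convexHull_face [TopologicalSpace 𝕜] [TopologicalSpace E] {l : StrongDual 𝕜 E}
    (hM : ∀ y ∈ s, l y ≤ M) :
    IsExposed 𝕜 (convexHull 𝕜 s) (convexHull 𝕜 {y ∈ s | l y = M}) := by
  intro hne
  obtain ⟨z, hzs, hz⟩ := convexHull_nonempty_iff.1 hne
  have hle : ∀ y ∈ convexHull 𝕜 s, l y ≤ M := fun y hy =>
    le_of_mem_convexHull (f := l.toLinearMap) hM hy
  refine ⟨l, Set.Subset.antisymm (fun y hy => ?_) fun y hy => ?_⟩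
  · have hyM : M ≤ l y := neg_le_neg_iff.1 <|
      le_of_mem_convexHull (f := -l.toLinearMap) (fun w hw => neg_le_neg hw.2.ge) hy
    exact ⟨convexHull_mono (Set.sep_subset _ _) hy, fun w hw => (hle w hw).trans hyM⟩
  · exact mem_convexHull_face (f := l.toLinearMap) hM hy.1
      ((hle y hy.1).antisymm (hz ▸ hy.2 z (subset_convexHull 𝕜 _ hzs)))

end Faces

section Plane

/-- The ordinate at `x` of the line through the points `p` and `q`; if that line is vertical, the
constant `p.2`. -/
noncomputable def lineThrough (p q : ℝ × ℝ) (x : ℝ) : ℝ :=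
  p.2 + (q.2 - p.2) / (q.1 - p.1) * (x - p.1)

variable {p q z : ℝ × ℝ} {P : Set (ℝ × ℝ)} {s x y : ℝ}

theorem lineThrough_left : lineThrough p q p.1 = p.2 := by
  rw [lineThrough, sub_self, mul_zero, add_zero]

theorem lineThrough_right (h : p.1 ≠ q.1) : lineThrough p q q.1 = q.2 := by
  rw [lineThrough, div_mul_cancel₀ _ (sub_ne_zero.2 h.symm), add_sub_cancel]

theorem mk_lineThrough_mem_segment (h : p.1 < q.1) (hx : x ∈ Set.Icc p.1 q.1) :
    (x, lineThrough p q x) ∈ segment ℝ p q := by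
  have hd : 0 < q.1 - p.1 := sub_pos.2 h
  rw [segment_eq_image']
  refine ⟨(x - p.1) / (q.1 - p.1),
    ⟨div_nonneg (sub_nonneg.2 hx.1) hd.le, div_le_one_of_le₀ (by linarith [hx.2]) hd.le⟩,
    Prod.ext ?_ ?_⟩
  · change p.1 + (x - p.1) / (q.1 - p.1) * (q.1 - p.1) = x
    rw [div_mul_cancel₀ _ hd.ne', add_sub_cancel]
  · change p.2 + (x - p.1) / (q.1 - p.1) * (q.2 - p.2) = lineThrough p q x
    rw [lineThrough]
    ring

theorem mk_lineThrough_mem_openSegment (h : p.1 < q.1) (hx : x ∈ Set.Ioo p.1 q.1) :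
    (x, lineThrough p q x) ∈ openSegment ℝ p q :=
  mem_openSegment_of_ne_left_right (fun hp => hx.1.ne (congrArg Prod.fst hp))
    (fun hq => hx.2.ne' (congrArg Prod.fst hq))
    (mk_lineThrough_mem_segment h (Set.Ioo_subset_Icc_self hx))

/-- The linear functional `z ↦ s * z.1 - z.2`, whose level sets are the lines of slope `s`; a point
of a set maximises it exactly if it lies on the lower supporting line of slope `s`. -/
noncomputable def slopeForm (s : ℝ) : ℝ × ℝ →L[ℝ] ℝ :=
  s • ContinuousLinearMap.fst ℝ ℝ ℝ - ContinuousLinearMap.snd ℝ ℝ ℝ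

theorem slopeForm_apply : slopeForm s z = s * z.1 - z.2 :=
  rfl

theorem lineThrough_le_iff :
    lineThrough p q z.1 ≤ z.2 ↔
      slopeForm ((q.2 - p.2) / (q.1 - p.1)) z ≤ slopeForm ((q.2 - p.2) / (q.1 - p.1)) p := by
  rw [slopeForm_apply, slopeForm_apply, lineThrough]
  constructor <;> intro h <;> linarith

theorem le_lineThrough_iff :
    z.2 ≤ lineThrough p q z.1 ↔
      slopeForm ((q.2 - p.2) / (q.1 - p.1)) p ≤ slopeForm ((q.2 - p.2) / (q.1 - p.1)) z := by
  rw [slopeForm_apply, slopeForm_apply, lineThrough]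
  constructor <;> intro h <;> linarith

theorem le_lineThrough_of_mem_convexHull (h : ∀ y ∈ P, y.2 ≤ lineThrough p q y.1)
    (hz : z ∈ convexHull ℝ P) : z.2 ≤ lineThrough p q z.1 := by
  have hle := le_of_mem_convexHull (f := -(slopeForm _).toLinearMap)
    (fun y hy => neg_le_neg (le_lineThrough_iff.1 (h y hy))) hz
  exact le_lineThrough_iff.2 (neg_le_neg_iff.1 hle)

theorem lt_lineThrough_of_slopeForm_lt (hz : z.1 ∈ Set.Ioo p.1 q.1)
    (hp : slopeForm s p < slopeForm s z) (hq : slopeForm s q < slopeForm s z) :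
    z.2 < lineThrough p q z.1 := by
  rw [slopeForm_apply, slopeForm_apply] at hp hq
  have hpz : 0 < (q.1 - z.1) * (p.2 - z.2 + s * (z.1 - p.1)) :=
    mul_pos (sub_pos.2 hz.2) (by linarith)
  have hqz : 0 < (z.1 - p.1) * (q.2 - z.2 + s * (z.1 - q.1)) :=
    mul_pos (sub_pos.2 hz.1) (by linarith)
  have hd : 0 < q.1 - p.1 := sub_pos.2 (hz.1.trans hz.2)
  have heq : lineThrough p q z.1 - z.2 =
      ((q.1 - z.1) * (p.2 - z.2) + (z.1 - p.1) * (q.2 - z.2)) / (q.1 - p.1) := by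
    rw [lineThrough]
    field_simp
    ring
  exact sub_pos.1 (heq ▸ div_pos (by linarith) hd)

theorem mk_mem_of_mem_Icc (hP : Convex ℝ P) {a b : ℝ} (ha : (x, a) ∈ P) (hb : (x, b) ∈ P)
    (hy : y ∈ Set.Icc a b) : (x, y) ∈ P := by
  have hmem : (x, y) ∈ segment ℝ (x, a) (x, b) := by
    rw [← Prod.image_mk_segment_right, segment_eq_Icc (hy.1.trans hy.2)]
    exact Set.mem_image_of_mem _ hy
  exact hP.segment_subset ha hb hmem

end Plane

section Chains

variable {k : ℕ} {v w : Fin (k + 1) → ℝ × ℝ} {m : Fin (k + 1)}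

theorem le_of_forall_fin_succ {α : Type*} [Preorder α] {f : Fin (k + 1) → α}
    (hmono : ∀ l : Fin k, l.castSucc < m → f l.castSucc ≤ f l.succ)
    (hanti : ∀ l : Fin k, m ≤ l.castSucc → f l.succ ≤ f l.castSucc) (n : Fin (k + 1)) :
    f n ≤ f m := by
  rcases le_total m n with h | h
  · induction n using Fin.induction with
    | zero => exact Fin.le_zero_iff.1 h ▸ le_rfl
    | succ l ih =>
      rcases h.eq_or_lt with rfl | h
      · exact le_rfl
      · have hl : m ≤ l.castSucc := Fin.le_castSucc_iff.2 h
        exact (hanti l hl).trans (ih hl)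
  · induction n using Fin.reverseInduction with
    | last => exact Fin.last_le_iff.1 h ▸ le_rfl
    | cast l ih =>
      rcases h.eq_or_lt with rfl | h
      · exact le_rfl
      · exact (hmono l h).trans (ih (Fin.castSucc_lt_iff_succ_le.1 h))

/-- The slope of the `l`-th edge of the polygonal chain `v`. -/
noncomputable def edgeSlope (v : Fin (k + 1) → ℝ × ℝ) (l : Fin k) : ℝ :=
  ((v l.succ).2 - (v l.castSucc).2) / ((v l.succ).1 - (v l.castSucc).1)

/-- The polygonal chain `v` runs from left to right and its edges become steeper and steeper: it is
the graph of a strictly convex piecewise linear function with breakpoints at the inner vertices. -/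
structure IsConvexChain (v : Fin (k + 1) → ℝ × ℝ) : Prop where
  strictMono_fst : StrictMono fun m => (v m).1
  strictMono_edgeSlope : StrictMono (edgeSlope v)

namespace IsConvexChain

theorem fst_lt_fst (hv : IsConvexChain v) (l : Fin k) : (v l.castSucc).1 < (v l.succ).1 :=
  hv.strictMono_fst Fin.castSucc_lt_succ

theorem snd_lt_snd (hv : IsConvexChain v)
    (h : ∀ m ≠ 0, (v 0).2 < (v m).2) (l : Fin k) : (v l.castSucc).2 < (v l.succ).2 := by
  obtain _ | k := k
  · exact l.elim0
  have hpos : 0 < edgeSlope v 0 :=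
    div_pos (sub_pos.2 (h _ (Fin.succ_ne_zero 0))) (sub_pos.2 (hv.fst_lt_fst 0))
  have hl : 0 < edgeSlope v l :=
    hpos.trans_le (hv.strictMono_edgeSlope.monotone (Fin.zero_le l))
  exact sub_pos.1 ((div_pos_iff_of_pos_right (sub_pos.2 (hv.fst_lt_fst l))).1 hl)

theorem slopeForm_succ_sub (hv : IsConvexChain v) (s : ℝ) (l : Fin k) :
    slopeForm s (v l.succ) - slopeForm s (v l.castSucc) =
      (s - edgeSlope v l) * ((v l.succ).1 - (v l.castSucc).1) := by
  have hd := (sub_pos.2 (hv.fst_lt_fst l)).ne'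
  rw [slopeForm_apply, slopeForm_apply, sub_mul, edgeSlope, div_mul_cancel₀ _ hd]
  ring

theorem slopeForm_le (hv : IsConvexChain v) {s : ℝ}
    (hbefore : ∀ l : Fin k, l.castSucc < m → edgeSlope v l ≤ s)
    (hafter : ∀ l : Fin k, m ≤ l.castSucc → s ≤ edgeSlope v l) (n : Fin (k + 1)) :
    slopeForm s (v n) ≤ slopeForm s (v m) := by
  have hd (l : Fin k) : 0 ≤ (v l.succ).1 - (v l.castSucc).1 := (sub_pos.2 (hv.fst_lt_fst l)).le
  refine le_of_forall_fin_succ (f := fun n => slopeForm s (v n)) (fun l hl => ?_)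
    (fun l hl => ?_) n
  · rw [← sub_nonneg, hv.slopeForm_succ_sub]
    exact mul_nonneg (sub_nonneg.2 (hbefore l hl)) (hd l)
  · rw [← sub_nonpos, hv.slopeForm_succ_sub]
    exact mul_nonpos_of_nonpos_of_nonneg (sub_nonpos.2 (hafter l hl)) (hd l)

theorem slopeForm_edgeSlope_le (hv : IsConvexChain v) (l : Fin k) (n : Fin (k + 1)) :
    slopeForm (edgeSlope v l) (v n) ≤ slopeForm (edgeSlope v l) (v l.castSucc) :=
  hv.slopeForm_le
    (fun _ hl => (hv.strictMono_edgeSlope (Fin.castSucc_lt_castSucc_iff.1 hl)).le)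
    (fun _ hl => hv.strictMono_edgeSlope.monotone (Fin.castSucc_le_castSucc_iff.1 hl)) n

theorem exists_slopeForm_lt (hv : IsConvexChain v) (m : Fin (k + 1)) :
    ∃ s, ∀ n ≠ m, slopeForm s (v n) < slopeForm s (v m) := by
  let before : Finset ℝ := ({l : Fin k | l.castSucc < m} : Finset _).image (edgeSlope v)
  let after : Finset ℝ := ({l : Fin k | m ≤ l.castSucc} : Finset _).image (edgeSlope v)
  have hsep : ∀ a ∈ before, ∀ b ∈ after, a < b := by
    simp only [before, after, Finset.forall_mem_image, Finset.mem_filter_univ]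
    exact fun l hl l' hl' =>
      hv.strictMono_edgeSlope (Fin.castSucc_lt_castSucc_iff.1 (hl.trans_le hl'))
  obtain ⟨s₁, hs₁, hs₁'⟩ := Order.exists_between_finsets before after hsep
  obtain ⟨s₂, hs₂, hs₂'⟩ := Order.exists_between_finsets {s₁} after
    (by simpa only [Finset.mem_singleton, forall_eq])
  simp only [Finset.mem_singleton, forall_eq] at hs₂
  have hbefore (l : Fin k) (hl : l.castSucc < m) : edgeSlope v l < s₁ :=
    hs₁ _ (Finset.mem_image_of_mem _ (Finset.mem_filter_univ l |>.2 hl))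
  have hafter (l : Fin k) (hl : m ≤ l.castSucc) : s₂ < edgeSlope v l :=
    hs₂' _ (Finset.mem_image_of_mem _ (Finset.mem_filter_univ l |>.2 hl))
  -- `v m` maximises the forms of both slopes, hence is the only maximiser for their mean.
  refine ⟨(s₁ + s₂) / 2, fun n hn => ?_⟩
  have h₁ := hv.slopeForm_le (fun l hl => (hbefore l hl).le)
    (fun l hl => (hs₂.trans (hafter l hl)).le) n
  have h₂ := hv.slopeForm_le (fun l hl => ((hbefore l hl).trans hs₂).le)
    (fun l hl => (hafter l hl).le) n
  simp only [slopeForm_apply] at h₁ h₂ ⊢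
  rcases (hv.strictMono_fst.injective.ne hn).lt_or_gt with h | h <;> nlinarith

theorem extremePoints_convexHull (hv : IsConvexChain v) :
    (convexHull ℝ (Set.range v)).extremePoints ℝ = Set.range v := by
  refine extremePoints_convexHull_subset.antisymm ?_
  rintro _ ⟨m, rfl⟩
  obtain ⟨s, hs⟩ := hv.exists_slopeForm_lt m
  refine mem_extremePoints_of_forall_lt (f := (slopeForm s).toLinearMap)
    (subset_convexHull ℝ _ ⟨m, rfl⟩) fun y hy hne => lt_of_mem_convexHull_of_ne ?_ hy hne
  rintro _ ⟨n, rfl⟩ hn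
  exact hs n fun h => hn (h ▸ rfl)

theorem isConvexLatticeGon (hv : IsConvexChain v)
    (hk : 1 ≤ k) (hlat : Set.range v ⊆ latticePoints) :
    IsConvexLatticeGon (k + 1) (convexHull ℝ (Set.range v)) := by
  refine ⟨Nat.succ_le_succ hk, ?_, ?_, ?_⟩ <;> rw [hv.extremePoints_convexHull]
  · exact hlat
  · rw [← Nat.card_coe_set_eq, Nat.card_range_of_injective hv.strictMono_fst.injective.of_comp,
      Nat.card_fin]

theorem eq_of_range_eq (hv : IsConvexChain v) (hw : IsConvexChain w)
    (h : Set.range v = Set.range w) : v = w := by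
  have hfst : (fun m => (v m).1) = fun m => (w m).1 := by
    rw [← hv.strictMono_fst.range_inj hw.strictMono_fst]
    exact (Set.range_comp Prod.fst v).trans (h ▸ (Set.range_comp Prod.fst w).symm)
  funext m
  obtain ⟨n, hn⟩ : v m ∈ Set.range w := h ▸ ⟨m, rfl⟩
  have hmn : n = m :=
    hw.strictMono_fst.injective ((congrArg Prod.fst hn).trans (congrFun hfst m))
  rw [← hn, hmn]

theorem snd_lt_lineThrough (hv : IsConvexChain v) (h0 : 0 < m) (hlast : m < Fin.last k) :
    (v m).2 < lineThrough (v 0) (v (Fin.last k)) (v m).1 := by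
  obtain ⟨s, hs⟩ := hv.exists_slopeForm_lt m
  exact lt_lineThrough_of_slopeForm_lt ⟨hv.strictMono_fst h0, hv.strictMono_fst hlast⟩
    (hs 0 h0.ne) (hs _ hlast.ne')

theorem lineThrough_last (hv : IsConvexChain v) :
    lineThrough (v 0) (v (Fin.last k)) (v (Fin.last k)).1 = (v (Fin.last k)).2 := by
  rcases (Fin.zero_le (Fin.last k)).eq_or_lt with h | h
  · rw [← h, lineThrough_left]
  · exact lineThrough_right (hv.strictMono_fst h).ne

theorem snd_le_lineThrough (hv : IsConvexChain v) (m : Fin (k + 1)) :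
    (v m).2 ≤ lineThrough (v 0) (v (Fin.last k)) (v m).1 := by
  rcases (Fin.zero_le m).eq_or_lt with rfl | h0
  · exact lineThrough_left.ge
  rcases (Fin.le_last m).eq_or_lt with rfl | hlast
  · exact hv.lineThrough_last.ge
  · exact (hv.snd_lt_lineThrough h0 hlast).le

theorem isExposed_segment (hv : IsConvexChain v) :
    IsExposed ℝ (convexHull ℝ (Set.range v)) (segment ℝ (v 0) (v (Fin.last k))) := by
  let l : StrongDual ℝ (ℝ × ℝ) :=
    -slopeForm (((v (Fin.last k)).2 - (v 0).2) / ((v (Fin.last k)).1 - (v 0).1))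
  have hle (m : Fin (k + 1)) : l (v m) ≤ l (v 0) :=
    neg_le_neg (le_lineThrough_iff.1 (hv.snd_le_lineThrough m))
  have hface : {y ∈ Set.range v | l y = l (v 0)} = {v 0, v (Fin.last k)} := by
    ext y
    constructor
    · rintro ⟨⟨m, rfl⟩, hm⟩
      rcases (Fin.zero_le m).eq_or_lt with rfl | h0
      · exact Or.inl rfl
      rcases (Fin.le_last m).eq_or_lt with rfl | hlast
      · exact Or.inr rfl
      · exact absurd (hv.snd_lt_lineThrough h0 hlast)
          (lineThrough_le_iff.2 (neg_le_neg_iff.1 hm.ge)).not_gt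
    · rintro (rfl | rfl)
      · exact ⟨⟨0, rfl⟩, rfl⟩
      · exact ⟨⟨_, rfl⟩, (hle _).antisymm
          (neg_le_neg (lineThrough_le_iff.1 hv.lineThrough_last.le))⟩
  rw [← convexHull_pair, ← hface]
  exact isExposed_convexHull_face (Set.forall_mem_range.2 hle)

theorem mem_convexHull_iff (hv : IsConvexChain v) (l : Fin k) {x y : ℝ}
    (hx : x ∈ Set.Icc (v l.castSucc).1 (v l.succ).1) :
    (x, y) ∈ convexHull ℝ (Set.range v) ↔
      y ∈ Set.Icc (lineThrough (v l.castSucc) (v l.succ) x)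
        (lineThrough (v 0) (v (Fin.last k)) x) := by
  have hk : 0 < Fin.last k := (Fin.zero_le _).trans_lt (Fin.castSucc_lt_last l)
  have hsub {m n : Fin (k + 1)} :
      segment ℝ (v m) (v n) ⊆ convexHull ℝ (Set.range v) :=
    segment_subset_convexHull ⟨m, rfl⟩ ⟨n, rfl⟩
  constructor
  · refine fun h => ⟨?_, ?_⟩
    · refine lineThrough_le_iff.2 (le_of_mem_convexHull (f := (slopeForm _).toLinearMap) ?_ h)
      exact Set.forall_mem_range.2 (hv.slopeForm_edgeSlope_le l)
    · exact le_lineThrough_of_mem_convexHull (Set.forall_mem_range.2 hv.snd_le_lineThrough) h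
  · have hx' : x ∈ Set.Icc (v 0).1 (v (Fin.last k)).1 :=
      ⟨(hv.strictMono_fst.monotone (Fin.zero_le _)).trans hx.1,
        hx.2.trans (hv.strictMono_fst.monotone (Fin.le_last _))⟩
    exact mk_mem_of_mem_Icc (convex_convexHull ℝ _)
      (hsub (mk_lineThrough_mem_segment (hv.fst_lt_fst l) hx))
      (hsub (mk_lineThrough_mem_segment (hv.strictMono_fst hk) hx'))

theorem lineThrough_le_lineThrough (hv : IsConvexChain v) (l : Fin k) {x : ℝ}
    (hx : x ∈ Set.Icc (v l.castSucc).1 (v l.succ).1) :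
    lineThrough (v l.castSucc) (v l.succ) x ≤ lineThrough (v 0) (v (Fin.last k)) x := by
  have hseg : segment ℝ (v l.castSucc) (v l.succ) ⊆ convexHull ℝ (Set.range v) :=
    segment_subset_convexHull ⟨_, rfl⟩ ⟨_, rfl⟩
  exact ((hv.mem_convexHull_iff l hx).1
    (hseg (mk_lineThrough_mem_segment (hv.fst_lt_fst l) hx))).2

theorem fst_mem_Icc_of_mem_convexHull (hv : IsConvexChain v) {p : ℝ × ℝ}
    (hp : p ∈ convexHull ℝ (Set.range v)) : p.1 ∈ Set.Icc (v 0).1 (v (Fin.last k)).1 := by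
  have hconv : Convex ℝ {p : ℝ × ℝ | p.1 ∈ Set.Icc (v 0).1 (v (Fin.last k)).1} :=
    (convex_Icc _ _).linear_preimage (LinearMap.fst ℝ ℝ ℝ)
  refine convexHull_min (Set.range_subset_iff.2 fun m => ?_) hconv hp
  exact ⟨hv.strictMono_fst.monotone (Fin.zero_le m), hv.strictMono_fst.monotone (Fin.le_last m)⟩

end IsConvexChain

end Chains

theorem exists_strictMono_comp_of_injOn {α β : Type*} [LinearOrder β] {s : Set α} {f : α → β}
    {n : ℕ} (hf : Set.InjOn f s) (hs : s.Finite) (hn : s.ncard = n) :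
    ∃ v : Fin n → α, Set.range v = s ∧ StrictMono (f ∘ v) := by
  have hcard : (hs.image f).toFinset.card = n := by
    rw [← Set.ncard_eq_toFinset_card (f '' s) (hs.image f), hf.ncard_image, hn]
  have hrange : Set.range ((hs.image f).toFinset.orderEmbOfFin hcard) = f '' s := by
    rw [Finset.range_orderEmbOfFin, Set.Finite.coe_toFinset]
  have hmem (m : Fin n) : (hs.image f).toFinset.orderEmbOfFin hcard m ∈ f '' s :=
    hrange.le ⟨m, rfl⟩
  choose v hvs hv using hmem
  refine ⟨v, (Set.range_subset_iff.2 hvs).antisymm fun a ha => ?_, fun m m' h => ?_⟩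
  · obtain ⟨m, hm⟩ := hrange.ge (Set.mem_image_of_mem f ha)
    exact ⟨m, hf (hvs m) ha ((hv m).trans hm)⟩
  · simpa only [Function.comp_apply, hv] using OrderEmbedding.strictMono _ h

section LowerBoundary

variable {P : Set (ℝ × ℝ)} {a b u v w : ℝ × ℝ} {k : ℕ}

/-- The points of `P` that are lowest on the vertical line through them. -/
def lowerBoundary (P : Set (ℝ × ℝ)) : Set (ℝ × ℝ) :=
  {p ∈ P | ∀ y, (p.1, y) ∈ P → p.2 ≤ y}

theorem injOn_fst_lowerBoundary : Set.InjOn Prod.fst (lowerBoundary P) := fun p hp q hq h =>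
  Prod.ext h <| (hp.2 q.2 (h ▸ hq.1)).antisymm (hq.2 p.2 (h ▸ hp.1))

theorem slope_lt_slope_of_mem_lowerBoundary (hP : Convex ℝ P) (hu : u ∈ P) (hw : w ∈ P)
    (hv : v ∈ P.extremePoints ℝ) (hvlow : v ∈ lowerBoundary P) (huv : u.1 < v.1)
    (hvw : v.1 < w.1) : (v.2 - u.2) / (v.1 - u.1) < (w.2 - v.2) / (w.1 - v.1) := by
  have huw : u.1 < w.1 := huv.trans hvw
  have hmem := mk_lineThrough_mem_openSegment huw ⟨huv, hvw⟩
  have hlt : v.2 < lineThrough u w v.1 := by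
    refine (hvlow.2 _ (hP.openSegment_subset hu hw hmem)).lt_of_ne fun h => huv.ne ?_
    exact congrArg Prod.fst (hv.2 hu hw (by rwa [← h] at hmem))
  rw [lineThrough, ← sub_lt_iff_lt_add', div_mul_eq_mul_div, lt_div_iff₀ (sub_pos.2 huw)] at hlt
  rw [div_lt_div_iff₀ (sub_pos.2 huv) (sub_pos.2 hvw)]
  linarith

theorem extremePoints_subset_lowerBoundary (hP : Convex ℝ P) (ha : a ∈ lowerBoundary P)
    (hb : b ∈ lowerBoundary P) (hab : a.1 < b.1) (hfst : ∀ p ∈ P, p.1 ∈ Set.Icc a.1 b.1)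
    (hsnd : ∀ p ∈ P, p.2 ≤ lineThrough a b p.1) : P.extremePoints ℝ ⊆ lowerBoundary P := by
  refine fun v hv => ⟨hv.1, fun y hy => ?_⟩
  have hv₂ := hsnd v hv.1
  rcases (hfst v hv.1).1.eq_or_lt with hav | hav
  · rw [← hav, lineThrough_left] at hv₂
    exact hv₂.trans (ha.2 y (hav ▸ hy))
  rcases (hfst v hv.1).2.eq_or_lt with hvb | hvb
  · rw [hvb, lineThrough_right hab.ne] at hv₂
    exact hv₂.trans (hb.2 y (hvb ▸ hy))
  have hmem := mk_lineThrough_mem_openSegment hab ⟨hav, hvb⟩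
  by_contra! hlt
  rcases hv₂.eq_or_lt with heq | hlt'
  · rw [← heq] at hmem
    exact hav.ne (congrArg Prod.fst (hv.2 ha.1 hb.1 hmem))
  · have hv_seg : v ∈ openSegment ℝ (v.1, y) (v.1, lineThrough a b v.1) := by
      rw [← Prod.image_mk_openSegment_right, openSegment_eq_Ioo (hlt.trans hlt')]
      exact ⟨v.2, ⟨hlt, hlt'⟩, rfl⟩
    have hy_eq := hv.2 hy (hP.openSegment_subset ha.1 hb.1 hmem) hv_seg
    exact hlt.ne (congrArg Prod.snd hy_eq)

theorem exists_isConvexChain_range_eq_extremePoints (hP : Convex ℝ P)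
    (hlow : P.extremePoints ℝ ⊆ lowerBoundary P) (hcard : (P.extremePoints ℝ).ncard = k + 1) :
    ∃ v : Fin (k + 1) → ℝ × ℝ, IsConvexChain v ∧ Set.range v = P.extremePoints ℝ := by
  obtain ⟨v, hrange, hmono⟩ := exists_strictMono_comp_of_injOn
    (injOn_fst_lowerBoundary.mono hlow) (Set.finite_of_ncard_ne_zero (by omega)) hcard
  have hext (m : Fin (k + 1)) : v m ∈ P.extremePoints ℝ := hrange ▸ ⟨m, rfl⟩
  refine ⟨v, ⟨hmono, fun l l' hll' => ?_⟩, hrange⟩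
  have hslope {m₀ m₁ m₂ : Fin (k + 1)} (h₀ : m₀ < m₁) (h₁ : m₁ < m₂) :=
    slope_lt_slope_of_mem_lowerBoundary hP (hext m₀).1 (hext m₂).1 (hext m₁) (hlow (hext m₁))
      (hmono h₀) (hmono h₁)
  rcases (Fin.succ_le_castSucc_iff.2 hll').eq_or_lt with h | h
  · simpa only [edgeSlope, h] using
      hslope (Fin.castSucc_lt_succ (i := l)) (Fin.succ_lt_succ_iff.2 hll')
  · exact (hslope Fin.castSucc_lt_succ h).trans (hslope h Fin.castSucc_lt_succ)

end LowerBoundary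

section LatticePoints

variable {K : Set (ℝ × ℝ)} {a b : ℤ}

/-- The inclusion of the lattice `ℤ²` into the plane. -/
def toPlane (p : ℤ × ℤ) : ℝ × ℝ :=
  (p.1, p.2)

theorem toPlane_injective : Function.Injective toPlane :=
  Int.cast_injective.prodMap Int.cast_injective

theorem finite_preimage_toPlane (hK : IsCompact K) : (toPlane ⁻¹' K).Finite :=
  ((Int.isClosedEmbedding_coe_real.prodMap Int.isClosedEmbedding_coe_real).isCompact_preimage
    hK).finite_of_discrete

theorem ncard_latticePoints_inter (K : Set (ℝ × ℝ)) :
    (latticePoints ∩ K).ncard = (toPlane ⁻¹' K).ncard := by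
  rw [← Set.ncard_image_of_injective _ toPlane_injective, Set.image_preimage_eq_range_inter]
  rfl

theorem interiorCount_add_boundaryCount (hK : IsCompact K) :
    interiorCount K + boundaryCount K = (toPlane ⁻¹' K).ncard := by
  have hfin := finite_preimage_toPlane hK
  have hint : toPlane ⁻¹' interior K ⊆ toPlane ⁻¹' K := Set.preimage_mono interior_subset
  rw [interiorCount, boundaryCount, ncard_latticePoints_inter, ncard_latticePoints_inter,
    hK.isClosed.frontier_eq, Set.preimage_sdiff, add_comm,
    Set.ncard_sdiff_add_ncard_of_subset hint hfin]

theorem ncard_preimage_toPlane_eq_sum (hK : IsCompact K)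
    (hfst : ∀ p ∈ K, p.1 ∈ Set.Icc (a : ℝ) b) :
    (toPlane ⁻¹' K).ncard = ∑ n ∈ Finset.Icc a b, {y : ℤ | toPlane (n, y) ∈ K}.ncard := by
  have hfin := finite_preimage_toPlane hK
  have hmaps : Set.MapsTo Prod.fst (hfin.toFinset : Set (ℤ × ℤ)) (Finset.Icc a b : Set ℤ) :=
      fun p hp => by
    have hp' := hfst _ (hfin.mem_toFinset.1 (Finset.mem_coe.1 hp))
    exact Finset.mem_coe.2 (Finset.mem_Icc.2 (hp'.imp Int.cast_le.1 Int.cast_le.1))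
  rw [Set.ncard_eq_toFinset_card _ hfin, Finset.card_eq_sum_card_fiberwise hmaps]
  refine Finset.sum_congr rfl fun n _ => ?_
  have hset : ({p ∈ hfin.toFinset | p.1 = n} : Finset (ℤ × ℤ)) =
      Prod.mk n '' {y : ℤ | toPlane (n, y) ∈ K} := by
    ext ⟨m, y⟩
    simp only [Finset.coe_filter, Set.Finite.mem_toFinset, Set.mem_preimage, Set.mem_ofPred_eq,
      Set.mem_image, Prod.mk.injEq]
    constructor
    · rintro ⟨h, rfl⟩
      exact ⟨y, h, rfl, rfl⟩
    · rintro ⟨y, h, rfl, rfl⟩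
      exact ⟨h, rfl⟩
  rw [← Set.ncard_coe_finset, hset, Set.ncard_image_of_injective _ (Prod.mk_right_injective n)]

theorem ncard_setOf_cast_mem_Icc {x y : ℝ} (h : x ≤ y) :
    ({n : ℤ | (n : ℝ) ∈ Set.Icc x y}.ncard : ℤ) = ⌊y⌋ + 1 - ⌈x⌉ := by
  have hle : ⌈x⌉ ≤ ⌊y⌋ + 1 := (Int.ceil_le_floor_add_one x).trans (by gcongr)
  have hset : {n : ℤ | (n : ℝ) ∈ Set.Icc x y} = Finset.Icc ⌈x⌉ ⌊y⌋ := by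
    rw [Finset.coe_Icc, ← Int.preimage_Icc]
    rfl
  rw [hset, Set.ncard_coe_finset, Int.card_Icc_of_le _ _ hle]

end LatticePoints

section LatticeLines

theorem card_filter_Ioc_dvd_mul {W : ℤ} (hW : 0 < W) (a H : ℤ) :
    ((Finset.Ioc a (a + W)).filter fun n => W ∣ (n - a) * H).card = Int.gcd W H := by
  have hg : (0 : ℤ) < Int.gcd W H := Int.natCast_pos.2 (Int.gcd_pos_of_ne_zero_left _ hW.ne')
  obtain ⟨r, hr⟩ := Int.gcd_dvd_left W H
  have hr0 : 0 < r := pos_of_mul_pos_right (hr ▸ hW) hg.le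
  have hiff (n : ℤ) : W ∣ (n - a) * H ↔ n ≡ a [ZMOD r] := by
    rw [← Int.dvd_mul_gcd_iff_dvd_mul, Int.modEq_comm, Int.modEq_iff_dvd, mul_comm]
    nth_rw 1 [hr]
    exact mul_dvd_mul_iff_left hg.ne'
  have hdiv : ((a + W : ℤ) - a : ℚ) / r = (Int.gcd W H : ℤ) := by
    have hWr : (W : ℚ) = Int.gcd W H * r := by exact_mod_cast hr
    have hr0' : (r : ℚ) ≠ 0 := by exact_mod_cast hr0.ne'
    rw [Int.cast_add, add_sub_cancel_left, div_eq_iff hr0', hWr, Int.cast_natCast]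
  have hcard := Int.Ioc_filter_modEq_card a (a + W) hr0 a
  rw [hdiv, sub_self, zero_div, Int.floor_intCast, Int.floor_zero, sub_zero,
    max_eq_left hg.le] at hcard
  simp only [hiff]
  exact_mod_cast hcard

variable {p q : ℤ × ℤ}

theorem lineThrough_toPlane (p q : ℤ × ℤ) (x : ℝ) : lineThrough (toPlane p) (toPlane q) x =
    p.2 + ((q.2 : ℝ) - p.2) / ((q.1 : ℝ) - p.1) * (x - p.1) :=
  rfl

theorem lineThrough_toPlane_mem_range_intCast_iff (h : p.1 < q.1) (n : ℤ) :
    lineThrough (toPlane p) (toPlane q) n ∈ Set.range ((↑) : ℤ → ℝ) ↔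
      q.1 - p.1 ∣ (n - p.1) * (q.2 - p.2) := by
  have hW : ((q.1 : ℝ) - p.1) ≠ 0 := sub_ne_zero.2 (Int.cast_lt.2 h).ne'
  have hiff (m : ℤ) : (m : ℝ) = lineThrough (toPlane p) (toPlane q) n ↔
      (n - p.1) * (q.2 - p.2) = (q.1 - p.1) * (m - p.2) := by
    rw [lineThrough_toPlane, ← sub_eq_iff_eq_add', div_mul_eq_mul_div, eq_div_iff hW,
      ← Int.cast_inj (α := ℝ)]
    push_cast
    constructor <;> intro h <;> linarith
  simp only [Set.mem_range, hiff]
  exact ⟨fun ⟨m, hm⟩ => ⟨_, hm⟩, fun ⟨m, hm⟩ => ⟨m + p.2, by rw [hm, add_sub_cancel_right]⟩⟩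

theorem lineThrough_toPlane_reflect (h : p.1 < q.1) (n : ℤ) :
    lineThrough (toPlane p) (toPlane q) (p.1 + q.1 - n : ℤ) =
      (p.2 + q.2 : ℤ) - lineThrough (toPlane p) (toPlane q) n := by
  have hW : ((q.1 : ℝ) - p.1) ≠ 0 := sub_ne_zero.2 (Int.cast_lt.2 h).ne'
  rw [lineThrough_toPlane, lineThrough_toPlane]
  push_cast
  field_simp
  ring

theorem sum_ceil_sub_floor_lineThrough (h : p.1 < q.1) :
    ∑ n ∈ Finset.Ioc p.1 q.1, (⌈lineThrough (toPlane p) (toPlane q) n⌉ -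
      ⌊lineThrough (toPlane p) (toPlane q) n⌋) =
        q.1 - p.1 - Int.gcd (q.1 - p.1) (q.2 - p.2) := by
  have hterm (n : ℤ) : ⌈lineThrough (toPlane p) (toPlane q) n⌉ -
      ⌊lineThrough (toPlane p) (toPlane q) n⌋ =
        1 - if q.1 - p.1 ∣ (n - p.1) * (q.2 - p.2) then 1 else 0 := by
    by_cases hn : q.1 - p.1 ∣ (n - p.1) * (q.2 - p.2)
    · obtain ⟨m, hm⟩ := (lineThrough_toPlane_mem_range_intCast_iff h n).2 hn
      rw [if_pos hn, ← hm, Int.ceil_intCast, Int.floor_intCast, sub_self, sub_self]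
    · rw [if_neg hn, (Int.ceil_eq_floor_add_one_iff_notMem _).2
        (mt (lineThrough_toPlane_mem_range_intCast_iff h n).1 hn), add_sub_cancel_left, sub_zero]
  have hcard := card_filter_Ioc_dvd_mul (sub_pos.2 h) p.1 (q.2 - p.2)
  rw [add_sub_cancel] at hcard
  rw [Finset.sum_congr rfl fun n _ => hterm n, Finset.sum_sub_distrib, Finset.sum_boole,
    hcard, Finset.sum_const, Int.card_Ioc, nsmul_one, Int.toNat_of_nonneg (sub_pos.2 h).le]

theorem sum_floor_add_ceil_lineThrough (h : p.1 < q.1) :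
    ∑ n ∈ Finset.Ioc p.1 q.1, (⌊lineThrough (toPlane p) (toPlane q) n⌋ +
      ⌈lineThrough (toPlane p) (toPlane q) n⌉) =
        (q.1 - p.1) * (p.2 + q.2) + (q.2 - p.2) := by
  -- The half-turn about the midpoint of `p` and `q` exchanges floors and ceilings.
  have hreflect : ∑ n ∈ Finset.Icc p.1 q.1, ⌈lineThrough (toPlane p) (toPlane q) n⌉ =
      ∑ n ∈ Finset.Icc p.1 q.1, (p.2 + q.2 - ⌊lineThrough (toPlane p) (toPlane q) n⌋) := by
    refine Finset.sum_equiv (Equiv.subLeft (p.1 + q.1)) (fun n => ?_) fun n _ => ?_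
    · simp only [Finset.mem_Icc, Equiv.subLeft_apply]
      omega
    · rw [Equiv.subLeft_apply, lineThrough_toPlane_reflect h, sub_eq_add_neg (_ : ℝ),
        Int.floor_intCast_add, Int.floor_neg]
      ring
  have hsum : ∑ n ∈ Finset.Icc p.1 q.1, (⌊lineThrough (toPlane p) (toPlane q) n⌋ +
      ⌈lineThrough (toPlane p) (toPlane q) n⌉) = (q.1 + 1 - p.1) * (p.2 + q.2) := by
    rw [Finset.sum_add_distrib, hreflect, Finset.sum_sub_distrib, add_sub_cancel,
      Finset.sum_const, nsmul_eq_mul, Int.card_Icc_of_le _ _ (by omega)]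
  have hleft : lineThrough (toPlane p) (toPlane q) p.1 = p.2 := lineThrough_left
  rw [← Finset.Ioc_insert_left h.le, Finset.sum_insert Finset.left_notMem_Ioc, hleft,
    Int.floor_intCast, Int.ceil_intCast] at hsum
  linarith

theorem two_mul_sum_floor_lineThrough (h : p.1 < q.1) :
    2 * ∑ n ∈ Finset.Ioc p.1 q.1, ⌊lineThrough (toPlane p) (toPlane q) n⌋ =
      (q.1 - p.1) * (p.2 + q.2 - 1) + (q.2 - p.2) + Int.gcd (q.1 - p.1) (q.2 - p.2) := by
  have hsub := sum_ceil_sub_floor_lineThrough h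
  have hadd := sum_floor_add_ceil_lineThrough h
  rw [Finset.sum_sub_distrib] at hsub
  rw [Finset.sum_add_distrib] at hadd
  linarith

theorem two_mul_sum_ceil_lineThrough (h : p.1 < q.1) :
    2 * ∑ n ∈ Finset.Ioc p.1 q.1, ⌈lineThrough (toPlane p) (toPlane q) n⌉ =
      (q.1 - p.1) * (p.2 + q.2 + 1) + (q.2 - p.2) - Int.gcd (q.1 - p.1) (q.2 - p.2) := by
  have hsub := sum_ceil_sub_floor_lineThrough h
  have hadd := sum_floor_add_ceil_lineThrough h
  rw [Finset.sum_sub_distrib] at hsub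
  rw [Finset.sum_add_distrib] at hadd
  linarith

end LatticeLines

section Pick

variable {k : ℕ}

theorem sum_fin_succ_sub_castSucc {M : Type*} [AddCommGroup M] (f : Fin (k + 1) → M) :
    ∑ l : Fin k, (f l.succ - f l.castSucc) = f (Fin.last k) - f 0 := by
  rw [Finset.sum_sub_distrib, sub_eq_sub_iff_add_eq_add, add_comm, ← Fin.sum_univ_succ,
    Fin.sum_univ_castSucc, add_comm]

theorem sum_Ioc_eq_sum_sum_Ioc {α M : Type*} [LinearOrder α] [LocallyFiniteOrder α]
    [AddCommMonoid M] {X : Fin (k + 1) → α} (hX : Monotone X) (f : α → M) :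
    ∑ n ∈ Finset.Ioc (X 0) (X (Fin.last k)), f n =
      ∑ l : Fin k, ∑ n ∈ Finset.Ioc (X l.castSucc) (X l.succ), f n := by
  induction k with
  | zero => rw [Fin.last_zero, Finset.Ioc_self, Finset.sum_empty, Finset.univ_eq_empty,
      Finset.sum_empty]
  | succ k ih =>
    have hinit := ih (hX.comp Fin.strictMono_castSucc.monotone)
    have hlast : X (Fin.last k).castSucc ≤ X (Fin.last (k + 1)) := hX (Fin.le_last _)
    rw [Fin.sum_univ_castSucc, Fin.succ_last,
      ← Finset.Ioc_union_Ioc_eq_Ioc (hX (Fin.zero_le _)) hlast,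
      Finset.sum_union (Finset.Ioc_disjoint_Ioc_of_le le_rfl)]
    exact congrArg (· + _) hinit

/-- The determinant of the vectors `p` and `q`: twice the signed area of the triangle with vertices
`0`, `p` and `q`. -/
def cross (p q : ℤ × ℤ) : ℤ :=
  p.1 * q.2 - q.1 * p.2

theorem cross_zero_right (p : ℤ × ℤ) : cross p 0 = 0 := by
  rw [cross, Prod.fst_zero, Prod.snd_zero, mul_zero, zero_mul, sub_zero]

namespace IsConvexChain

variable {w : Fin (k + 1) → ℤ × ℤ}

theorem ncard_column (hw : IsConvexChain (toPlane ∘ w)) (l : Fin k) {n : ℤ}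
    (hn : n ∈ Finset.Icc (w l.castSucc).1 (w l.succ).1) :
    ({y : ℤ | toPlane (n, y) ∈ convexHull ℝ (Set.range (toPlane ∘ w))}.ncard : ℤ) =
      ⌊lineThrough (toPlane (w 0)) (toPlane (w (Fin.last k))) n⌋ + 1 -
        ⌈lineThrough (toPlane (w l.castSucc)) (toPlane (w l.succ)) n⌉ := by
  have hn' : (n : ℝ) ∈ Set.Icc ((toPlane ∘ w) l.castSucc).1 ((toPlane ∘ w) l.succ).1 :=
    (Finset.mem_Icc.1 hn).imp Int.cast_le.2 Int.cast_le.2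
  have hcol : {y : ℤ | toPlane (n, y) ∈ convexHull ℝ (Set.range (toPlane ∘ w))} =
      {y : ℤ | (y : ℝ) ∈ Set.Icc (lineThrough (toPlane (w l.castSucc)) (toPlane (w l.succ)) n)
        (lineThrough (toPlane (w 0)) (toPlane (w (Fin.last k))) n)} :=
    Set.ext fun y => hw.mem_convexHull_iff l hn'
  rw [hcol]
  exact ncard_setOf_cast_mem_Icc (hw.lineThrough_le_lineThrough l hn')

theorem ncard_preimage_toPlane_convexHull (hw : IsConvexChain (toPlane ∘ w)) (hk : 0 < k) :
    ((toPlane ⁻¹' convexHull ℝ (Set.range (toPlane ∘ w))).ncard : ℤ) =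
      1 + ∑ n ∈ Finset.Ioc (w 0).1 (w (Fin.last k)).1,
          (⌊lineThrough (toPlane (w 0)) (toPlane (w (Fin.last k))) n⌋ + 1) -
        ∑ l : Fin k, ∑ n ∈ Finset.Ioc (w l.castSucc).1 (w l.succ).1,
          ⌈lineThrough (toPlane (w l.castSucc)) (toPlane (w l.succ)) n⌉ := by
  have hcompact : IsCompact (convexHull ℝ (Set.range (toPlane ∘ w))) :=
    (Set.finite_range _).isCompact_convexHull ℝ
  have hmono : Monotone fun m => (w m).1 := fun m n h =>
    Int.cast_le.1 (hw.strictMono_fst.monotone h)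
  obtain ⟨k, rfl⟩ := Nat.exists_eq_succ_of_ne_zero hk.ne'
  have hfirst := hw.ncard_column 0 (Finset.left_mem_Icc.2 (hmono (Fin.zero_le _)))
  have hleft (q : ℝ × ℝ) : lineThrough (toPlane (w 0)) q (w 0).1 = (w 0).2 := lineThrough_left
  rw [Fin.castSucc_zero, hleft, hleft, Int.floor_intCast, Int.ceil_intCast,
    add_sub_cancel_left] at hfirst
  rw [ncard_preimage_toPlane_eq_sum hcompact fun p hp => hw.fst_mem_Icc_of_mem_convexHull hp,
    ← Finset.Ioc_insert_left (hmono (Fin.zero_le _)), Finset.sum_insert Finset.left_notMem_Ioc,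
    Nat.cast_add, hfirst, Nat.cast_sum, sum_Ioc_eq_sum_sum_Ioc hmono, sum_Ioc_eq_sum_sum_Ioc hmono,
    add_sub_assoc, ← Finset.sum_sub_distrib]
  refine congrArg (1 + ·) (Finset.sum_congr rfl fun l _ => ?_)
  rw [← Finset.sum_sub_distrib]
  exact Finset.sum_congr rfl fun n hn => hw.ncard_column l (Finset.Ioc_subset_Icc_self hn)

theorem two_mul_ncard_preimage_toPlane_convexHull (hw : IsConvexChain (toPlane ∘ w)) (hk : 0 < k) :
    (2 * (toPlane ⁻¹' convexHull ℝ (Set.range (toPlane ∘ w))).ncard : ℤ) =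
      ∑ l : Fin k, cross (w l.castSucc) (w l.succ) + cross (w (Fin.last k)) (w 0) +
        ∑ l : Fin k, (Int.gcd ((w l.succ).1 - (w l.castSucc).1)
          ((w l.succ).2 - (w l.castSucc).2) : ℤ) +
        Int.gcd ((w (Fin.last k)).1 - (w 0).1) ((w (Fin.last k)).2 - (w 0).2) + 2 := by
  have hfst {m n : Fin (k + 1)} (h : m < n) : (w m).1 < (w n).1 :=
    Int.cast_lt.1 (hw.strictMono_fst h)
  have hlast : (w 0).1 < (w (Fin.last k)).1 := hfst (Fin.lt_def.2 hk)
  have hceil : 2 * ∑ l : Fin k, ∑ n ∈ Finset.Ioc (w l.castSucc).1 (w l.succ).1,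
        ⌈lineThrough (toPlane (w l.castSucc)) (toPlane (w l.succ)) n⌉ =
      ∑ l : Fin k, (((w l.succ).1 * ((w l.succ).2 + 1) + (w l.succ).2) -
        ((w l.castSucc).1 * ((w l.castSucc).2 + 1) + (w l.castSucc).2)) -
      ∑ l : Fin k, cross (w l.castSucc) (w l.succ) -
      ∑ l : Fin k, (Int.gcd ((w l.succ).1 - (w l.castSucc).1)
          ((w l.succ).2 - (w l.castSucc).2) : ℤ) := by
    rw [Finset.mul_sum, ← Finset.sum_sub_distrib, ← Finset.sum_sub_distrib]
    refine Finset.sum_congr rfl fun l _ => ?_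
    rw [two_mul_sum_ceil_lineThrough (hfst Fin.castSucc_lt_succ), cross]
    ring
  have hfloor := two_mul_sum_floor_lineThrough hlast
  rw [sum_fin_succ_sub_castSucc fun m => (w m).1 * ((w m).2 + 1) + (w m).2] at hceil
  rw [hw.ncard_preimage_toPlane_convexHull hk, Finset.sum_add_distrib, Finset.sum_const,
    nsmul_one, Int.card_Ioc, Int.toNat_of_nonneg (sub_pos.2 hlast).le, cross]
  linarith

end IsConvexChain

end Pick

section PartialSums

variable {i j k : ℕ} {c : Fin k → ℕ × ℕ}

theorem sum_filter_castSucc_lt_succ {M : Type*} [AddCommMonoid M] (f : Fin k → M) (l : Fin k) :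
    ∑ l' with l'.castSucc < l.succ, f l' = ∑ l' with l'.castSucc < l.castSucc, f l' + f l := by
  have hfilter : ({l' | l'.castSucc < l.succ} : Finset (Fin k)) =
      insert l ({l' | l'.castSucc < l.castSucc} : Finset (Fin k)) := by
    ext l'
    simp only [Finset.mem_filter_univ, Finset.mem_insert, Fin.castSucc_lt_succ_iff,
      Fin.castSucc_lt_castSucc_iff, le_iff_eq_or_lt]
  rw [hfilter, Finset.sum_insert (by simp only [Finset.mem_filter_univ, lt_self_iff_false,
    not_false_eq_true]), add_comm]

/-- The partial sum `pathVertex c m` as a point of the lattice `ℤ²`. -/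
def latticeVertex (c : Fin k → ℕ × ℕ) (m : Fin (k + 1)) : ℤ × ℤ :=
  (∑ l with l.castSucc < m, ((c l).1 : ℤ), ∑ l with l.castSucc < m, ((c l).2 : ℤ))

theorem latticeVertex_zero (c : Fin k → ℕ × ℕ) : latticeVertex c 0 = 0 := by
  simp only [latticeVertex, Fin.not_lt_zero, Finset.filter_false, Finset.sum_empty,
    Prod.mk_zero_zero]

theorem latticeVertex_last (c : Fin k → ℕ × ℕ) :
    latticeVertex c (Fin.last k) = (((∑ l, (c l).1 : ℕ) : ℤ), ((∑ l, (c l).2 : ℕ) : ℤ)) := by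
  simp only [latticeVertex, Fin.castSucc_lt_last, Finset.filter_true, Nat.cast_sum]

theorem latticeVertex_succ (c : Fin k → ℕ × ℕ) (l : Fin k) :
    latticeVertex c l.succ = latticeVertex c l.castSucc + (((c l).1 : ℤ), ((c l).2 : ℤ)) :=
  Prod.ext (sum_filter_castSucc_lt_succ _ l) (sum_filter_castSucc_lt_succ _ l)

theorem toPlane_comp_latticeVertex (c : Fin k → ℕ × ℕ) :
    toPlane ∘ latticeVertex c = pathVertex c := by
  funext m
  simp only [Function.comp_apply, toPlane, latticeVertex, pathVertex, Int.cast_sum,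
    Int.cast_natCast]

theorem pathVertex_zero (c : Fin k → ℕ × ℕ) : pathVertex c 0 = (0, 0) := by
  simp only [pathVertex, Fin.not_lt_zero, Finset.filter_false, Finset.sum_empty]

theorem pathVertex_last (c : Fin k → ℕ × ℕ) :
    pathVertex c (Fin.last k) = (((∑ l, (c l).1 : ℕ) : ℝ), ((∑ l, (c l).2 : ℕ) : ℝ)) := by
  simp only [pathVertex, Fin.castSucc_lt_last, Finset.filter_true, Nat.cast_sum]

theorem pathVertex_succ (c : Fin k → ℕ × ℕ) (l : Fin k) :
    pathVertex c l.succ = pathVertex c l.castSucc + (((c l).1 : ℝ), ((c l).2 : ℝ)) :=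
  Prod.ext (sum_filter_castSucc_lt_succ _ l) (sum_filter_castSucc_lt_succ _ l)

theorem pathVertex_injective : Function.Injective (pathVertex (k := k)) := by
  refine fun c c' h => funext fun l => ?_
  have hsucc := congrFun h l.succ
  rw [pathVertex_succ, pathVertex_succ, h, add_right_inj, Prod.mk.injEq, Nat.cast_inj,
    Nat.cast_inj] at hsucc
  exact Prod.ext hsucc.1 hsucc.2

theorem exists_pathVertex_eq {v : Fin (k + 1) → ℝ × ℝ} (hlat : Set.range v ⊆ latticePoints)
    (h0 : v 0 = (0, 0)) (hle : ∀ l : Fin k, v l.castSucc ≤ v l.succ) : ∃ c, pathVertex c = v := by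
  have hlattice (m : Fin (k + 1)) : ∃ w : ℤ × ℤ, ((w.1 : ℝ), (w.2 : ℝ)) = v m := hlat ⟨m, rfl⟩
  choose w hw using hlattice
  have hstep (l : Fin k) :
      ∃ n : ℕ × ℕ, v l.succ = v l.castSucc + ((n.1 : ℝ), (n.2 : ℝ)) := by
    have hl := hle l
    rw [← hw, ← hw, Prod.mk_le_mk, Int.cast_le, Int.cast_le] at hl
    obtain ⟨n₁, hn₁⟩ := Int.le.dest hl.1
    obtain ⟨n₂, hn₂⟩ := Int.le.dest hl.2
    refine ⟨(n₁, n₂), ?_⟩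
    rw [← hw, ← hw, ← hn₁, ← hn₂, Prod.mk_add_mk, Int.cast_add, Int.cast_add, Int.cast_natCast,
      Int.cast_natCast]
  choose c hc using hstep
  refine ⟨c, funext fun m => ?_⟩
  induction m using Fin.induction with
  | zero => rw [pathVertex_zero, h0]
  | succ l ih => rw [pathVertex_succ, ih, hc]

theorem edgeSlope_pathVertex (c : Fin k → ℕ × ℕ) (l : Fin k) :
    edgeSlope (pathVertex c) l = ((c l).2 : ℝ) / (c l).1 := by
  rw [edgeSlope, pathVertex_succ, Prod.fst_add, Prod.snd_add, add_sub_cancel_left,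
    add_sub_cancel_left]

theorem isConvexChain_pathVertex_iff : IsConvexChain (pathVertex c) ↔
    (∀ l, 0 < (c l).1) ∧ StrictMono fun l => ((c l).2 : ℚ) / ((c l).1 : ℚ) := by
  have hfst : StrictMono (fun m => (pathVertex c m).1) ↔ ∀ l, 0 < (c l).1 := by
    simp only [Fin.strictMono_iff_lt_succ, pathVertex_succ, Prod.fst_add, lt_add_iff_pos_right,
      Nat.cast_pos]
  have hslope : StrictMono (edgeSlope (pathVertex c)) ↔
      StrictMono fun l => ((c l).2 : ℚ) / ((c l).1 : ℚ) := by
    have hcast (l : Fin k) : edgeSlope (pathVertex c) l = (((c l).2 / (c l).1 : ℚ) : ℝ) := by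
      rw [edgeSlope_pathVertex, Rat.cast_div, Rat.cast_natCast, Rat.cast_natCast]
    simp only [StrictMono, hcast, Rat.cast_lt]
  exact ⟨fun h => ⟨hfst.1 h.1, hslope.1 h.2⟩, fun h => ⟨hfst.2 h.1, hslope.2 h.2⟩⟩

theorem mem_slopeSequences_iff : c ∈ slopeSequences i j k ↔
    IsConvexChain (pathVertex c) ∧ (∀ l, 0 < (c l).2) ∧
      pathVertex c (Fin.last k) = ((i : ℝ), (j : ℝ)) := by
  rw [isConvexChain_pathVertex_iff, pathVertex_last, Prod.mk.injEq, Nat.cast_inj, Nat.cast_inj]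
  constructor
  · rintro ⟨hpos, hi, hj, hslope⟩
    exact ⟨⟨fun l => (hpos l).1, hslope⟩, fun l => (hpos l).2, hi, hj⟩
  · rintro ⟨⟨hfst, hslope⟩, hsnd, hi, hj⟩
    exact ⟨fun l => ⟨hfst l, hsnd l⟩, hi, hj, hslope⟩

theorem strictMono_snd_pathVertex (hc : ∀ l, 0 < (c l).2) :
    StrictMono fun m => (pathVertex c m).2 := by
  simpa only [Fin.strictMono_iff_lt_succ, pathVertex_succ, Prod.snd_add, lt_add_iff_pos_right,
    Nat.cast_pos]

theorem sum_cross_latticeVertex (c : Fin k → ℕ × ℕ) :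
    ((∑ l : Fin k, cross (latticeVertex c l.castSucc) (latticeVertex c l.succ) : ℤ) : ℝ) =
      ∑ l₁, ∑ l₂ ∈ Finset.Ioi l₁,
        (((c l₁).1 : ℝ) * ((c l₂).2 : ℝ) - ((c l₂).1 : ℝ) * ((c l₁).2 : ℝ)) := by
  rw [Finset.sum_comm' (t' := Finset.univ) (s' := Finset.Iio)
    fun _ _ => by simp only [Finset.mem_univ, Finset.mem_Ioi, Finset.mem_Iio, true_and, and_true],
    Int.cast_sum]
  refine Finset.sum_congr rfl fun l _ => ?_
  have hIio : ({l' | l'.castSucc < l.castSucc} : Finset (Fin k)) = Finset.Iio l := by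
    ext l'
    simp only [Finset.mem_filter_univ, Finset.mem_Iio, Fin.castSucc_lt_castSucc_iff]
  rw [latticeVertex_succ, Finset.sum_sub_distrib, ← Finset.sum_mul, ← Finset.mul_sum]
  simp only [cross, latticeVertex, hIio, Prod.fst_add, Prod.snd_add]
  push_cast
  ring

end PartialSums

section Gons

variable {i j k : ℕ} {c : Fin k → ℕ × ℕ} {p : ℝ × ℝ} {P : Set (ℝ × ℝ)}

theorem mem_triangleDelta_iff (hi : 0 < i) : p ∈ triangleDelta i j ↔
    p.1 ∈ Set.Icc (0 : ℝ) i ∧ p.2 ∈ Set.Icc 0 (lineThrough (0, 0) (i, j) p.1) := by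
  have hi' : (0 : ℝ) < i := Nat.cast_pos.2 hi
  have hj' : (0 : ℝ) ≤ j := j.cast_nonneg
  have hline : lineThrough (0, 0) ((i : ℝ), (j : ℝ)) i = j := lineThrough_right hi'.ne
  constructor
  · intro hp
    have hbox : p ∈ Set.Icc (0 : ℝ) i ×ˢ Set.Ici (0 : ℝ) := by
      refine convexHull_min ?_ ((convex_Icc 0 (i : ℝ)).prod (convex_Ici 0)) hp
      rintro _ (rfl | rfl | rfl)
      exacts [⟨⟨le_rfl, hi'.le⟩, le_refl (0 : ℝ)⟩, ⟨⟨hi'.le, le_rfl⟩, le_refl (0 : ℝ)⟩,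
        ⟨⟨hi'.le, le_rfl⟩, hj'⟩]
    refine ⟨hbox.1, hbox.2, le_lineThrough_of_mem_convexHull ?_ hp⟩
    rintro _ (rfl | rfl | rfl)
    exacts [lineThrough_left.ge, hj'.trans hline.ge, hline.ge]
  · rintro ⟨hx, hy⟩
    have hleg : (p.1, (0 : ℝ)) ∈ segment ℝ ((0 : ℝ), (0 : ℝ)) ((i : ℝ), (0 : ℝ)) := by
      rw [← Prod.image_mk_segment_left, segment_eq_Icc hi'.le]
      exact Set.mem_image_of_mem _ hx
    have hdiag := mk_lineThrough_mem_segment (p := (0, 0)) (q := ((i : ℝ), (j : ℝ))) hi' hx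
    exact mk_mem_of_mem_Icc (convex_convexHull ℝ _)
      (segment_subset_convexHull (by simp) (by simp) hleg)
      (segment_subset_convexHull (by simp) (by simp) hdiag) hy

theorem mem_legsDelta_iff (hi : 0 < i) (hp : p ∈ triangleDelta i j) :
    p ∈ legsDelta i j ↔ p.2 = 0 ∨ p.1 = i := by
  obtain ⟨hx, hy⟩ := (mem_triangleDelta_iff hi).1 hp
  rw [legsDelta, ← Prod.image_mk_segment_left, ← Prod.image_mk_segment_right,
    segment_eq_Icc i.cast_nonneg, segment_eq_Icc j.cast_nonneg]
  constructor
  · rintro (⟨x, -, rfl⟩ | ⟨y, -, rfl⟩)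
    exacts [Or.inl rfl, Or.inr rfl]
  · rintro (h | h)
    · exact Or.inl ⟨p.1, hx, Prod.ext rfl h.symm⟩
    · have hline : lineThrough (0, 0) ((i : ℝ), (j : ℝ)) i = j :=
        lineThrough_right (Nat.cast_pos.2 hi).ne
      rw [h, hline] at hy
      exact Or.inr ⟨p.2, hy, Prod.ext h.symm rfl⟩

theorem pathPolygon_subset_triangleDelta (hi : 0 < i) (hc : c ∈ slopeSequences i j k) :
    pathPolygon c ⊆ triangleDelta i j := by
  obtain ⟨hchain, hsnd, hlast⟩ := mem_slopeSequences_iff.1 hc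
  refine convexHull_min (Set.range_subset_iff.2 fun m => ?_) (convex_convexHull ℝ _)
  have hle := hchain.snd_le_lineThrough m
  have hx := hchain.fst_mem_Icc_of_mem_convexHull (subset_convexHull ℝ _ ⟨m, rfl⟩)
  have hy := (strictMono_snd_pathVertex hsnd).monotone (Fin.zero_le m)
  simp only [pathVertex_zero, hlast] at hle hx hy
  exact (mem_triangleDelta_iff hi).2 ⟨hx, hy, hle⟩

theorem pathPolygon_inter_legsDelta_subset (hi : 0 < i) (hc : c ∈ slopeSequences i j k) :
    pathPolygon c ∩ legsDelta i j ⊆ {((0 : ℝ), (0 : ℝ)), ((i : ℝ), (j : ℝ))} := by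
  obtain ⟨hchain, hsnd, hlast⟩ := mem_slopeSequences_iff.1 hc
  rintro p ⟨hp, hleg⟩
  rw [← pathVertex_zero c, ← hlast]
  rcases (mem_legsDelta_iff hi (pathPolygon_subset_triangleDelta hi hc hp)).1 hleg with hy | hx
  · refine Or.inl (by_contra fun hne => ?_)
    have hlt : -p.2 < -(pathVertex c 0).2 := by
      refine lt_of_mem_convexHull_of_ne (f := -LinearMap.snd ℝ ℝ ℝ) ?_ hp hne
      rintro _ ⟨m, rfl⟩ hm
      refine neg_lt_neg (strictMono_snd_pathVertex hsnd (Fin.pos_iff_ne_zero.2 fun h => hm ?_))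
      rw [h]
    rw [pathVertex_zero, hy] at hlt
    exact lt_irrefl _ hlt
  · refine Or.inr (by_contra fun hne => ?_)
    have hlt : p.1 < (pathVertex c (Fin.last k)).1 := by
      refine lt_of_mem_convexHull_of_ne (f := LinearMap.fst ℝ ℝ ℝ) ?_ hp hne
      rintro _ ⟨m, rfl⟩ hm
      refine hchain.strictMono_fst (Fin.lt_last_iff_ne_last.2 fun h => hm ?_)
      rw [h]
    rw [hlast, hx] at hlt
    exact lt_irrefl _ hlt

theorem mapsTo_pathPolygon (hi : 0 < i) (hk : 1 ≤ k) :
    Set.MapsTo pathPolygon (slopeSequences i j k) (gonsInDelta i j (k + 1)) := by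
  intro c hc
  obtain ⟨hchain, -, hlast⟩ := mem_slopeSequences_iff.1 hc
  have hlat : Set.range (pathVertex c) ⊆ latticePoints := by
    rw [← toPlane_comp_latticeVertex]
    exact Set.range_comp_subset_range _ toPlane
  refine ⟨hchain.isConvexLatticeGon hk hlat, pathPolygon_subset_triangleDelta hi hc,
    pathPolygon_inter_legsDelta_subset hi hc, fun h => ?_, ?_⟩
  · exact (Nat.cast_pos.2 hi).ne (congrArg Prod.fst h)
  · have hseg := hchain.isExposed_segment
    rwa [pathVertex_zero, hlast] at hseg

theorem injOn_pathPolygon : Set.InjOn pathPolygon (slopeSequences i j k) := by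
  intro c hc c' hc' h
  have hchain := (mem_slopeSequences_iff.1 hc).1
  have hchain' := (mem_slopeSequences_iff.1 hc').1
  refine pathVertex_injective (hchain.eq_of_range_eq hchain' ?_)
  rw [← hchain.extremePoints_convexHull, ← hchain'.extremePoints_convexHull]
  exact congrArg (Set.extremePoints ℝ) h

theorem mk_zero_mem_lowerBoundary (hi : 0 < i) (hP : P ⊆ triangleDelta i j)
    (ha : (0, 0) ∈ P) : (0, 0) ∈ lowerBoundary P :=
  ⟨ha, fun _ hy => ((mem_triangleDelta_iff hi).1 (hP hy)).2.1⟩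

theorem mk_natCast_mem_lowerBoundary (hi : 0 < i) (hP : P ⊆ triangleDelta i j)
    (hlegs : P ∩ legsDelta i j ⊆ {((0 : ℝ), (0 : ℝ)), ((i : ℝ), (j : ℝ))})
    (hb : ((i : ℝ), (j : ℝ)) ∈ P) : ((i : ℝ), (j : ℝ)) ∈ lowerBoundary P := by
  refine ⟨hb, fun y hy => ?_⟩
  rcases hlegs ⟨hy, (mem_legsDelta_iff hi (hP hy)).2 (Or.inr rfl)⟩ with h | h
  · exact absurd (congrArg Prod.fst h) (Nat.cast_pos.2 hi).ne'
  · exact (congrArg Prod.snd h).ge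

theorem exists_isConvexChain_of_mem_gonsInDelta (hi : 0 < i) (hP : P ∈ gonsInDelta i j (k + 1)) :
    ∃ v : Fin (k + 1) → ℝ × ℝ, IsConvexChain v ∧ Set.range v = P.extremePoints ℝ ∧
      v 0 = (0, 0) ∧ v (Fin.last k) = ((i : ℝ), (j : ℝ)) := by
  obtain ⟨⟨-, -, hcard, hhull⟩, hsub, hlegs, -, hedge⟩ := hP
  have hconv : Convex ℝ P := hhull ▸ convex_convexHull ℝ _
  have hbox (p : ℝ × ℝ) (hp : p ∈ P) := (mem_triangleDelta_iff hi).1 (hsub hp)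
  have ha := mk_zero_mem_lowerBoundary hi hsub (hedge.subset (left_mem_segment ℝ _ _))
  have hb := mk_natCast_mem_lowerBoundary hi hsub hlegs (hedge.subset (right_mem_segment ℝ _ _))
  have hlow := extremePoints_subset_lowerBoundary hconv ha hb (Nat.cast_pos.2 hi)
    (fun p hp => (hbox p hp).1) (fun p hp => (hbox p hp).2.2)
  obtain ⟨v, hv, hrange⟩ := exists_isConvexChain_range_eq_extremePoints hconv hlow hcard
  rw [← hrange] at hhull hlow
  have hvP (m : Fin (k + 1)) : v m ∈ P := (hlow ⟨m, rfl⟩).1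
  refine ⟨v, hv, hrange, injOn_fst_lowerBoundary (hlow ⟨0, rfl⟩) ha ?_,
    injOn_fst_lowerBoundary (hlow ⟨_, rfl⟩) hb ?_⟩
  · exact (hv.fst_mem_Icc_of_mem_convexHull (hhull ▸ ha.1)).1.antisymm (hbox _ (hvP 0)).1.1
  · exact (hbox _ (hvP _)).1.2.antisymm (hv.fst_mem_Icc_of_mem_convexHull (hhull ▸ hb.1)).2

theorem surjOn_pathPolygon (hi : 0 < i) (hj : 0 < j) :
    Set.SurjOn pathPolygon (slopeSequences i j k) (gonsInDelta i j (k + 1)) := by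
  intro P hP
  obtain ⟨v, hv, hrange, h0, hlast⟩ := exists_isConvexChain_of_mem_gonsInDelta hi hP
  obtain ⟨⟨-, hlat, -, hhull⟩, hsub, hlegs, -⟩ := hP
  rw [← hrange] at hlat hhull
  have hsnd_pos (m : Fin (k + 1)) (hm : m ≠ 0) : (v 0).2 < (v m).2 := by
    have hmem : v m ∈ P := hrange.le.trans extremePoints_subset ⟨m, rfl⟩
    have hnonneg := ((mem_triangleDelta_iff hi).1 (hsub hmem)).2.1
    rw [h0]
    refine hnonneg.lt_of_ne fun h => ?_
    rcases hlegs ⟨hmem, (mem_legsDelta_iff hi (hsub hmem)).2 (Or.inl h.symm)⟩ with hva | hvb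
    · exact hm (hv.strictMono_fst.injective (congrArg Prod.fst (hva.trans h0.symm)))
    · exact (Nat.cast_pos.2 hj).ne (h.trans (congrArg Prod.snd hvb))
  have hsnd := hv.snd_lt_snd hsnd_pos
  obtain ⟨c, rfl⟩ := exists_pathVertex_eq hlat h0 fun l => ⟨(hv.fst_lt_fst l).le, (hsnd l).le⟩
  refine ⟨c, mem_slopeSequences_iff.2 ⟨hv, fun l => ?_, hlast⟩, hhull.symm⟩
  simpa only [pathVertex_succ, Prod.snd_add, lt_add_iff_pos_right, Nat.cast_pos] using hsnd l

theorem two_mul_interiorCount_add_boundaryCount (hk : 0 < k) (hc : c ∈ slopeSequences i j k) :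
    (2 * (interiorCount (pathPolygon c) + boundaryCount (pathPolygon c)) : ℝ) =
      ∑ l₁, ∑ l₂ ∈ Finset.Ioi l₁,
          (((c l₁).1 : ℝ) * ((c l₂).2 : ℝ) - ((c l₂).1 : ℝ) * ((c l₁).2 : ℝ)) +
        ∑ l, (Nat.gcd (c l).1 (c l).2 : ℝ) + Nat.gcd i j + 2 := by
  have hchain := (mem_slopeSequences_iff.1 hc).1
  rw [← toPlane_comp_latticeVertex] at hchain
  have hgcd (l : Fin k) : Int.gcd ((latticeVertex c l.succ).1 - (latticeVertex c l.castSucc).1)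
      ((latticeVertex c l.succ).2 - (latticeVertex c l.castSucc).2) =
        Nat.gcd (c l).1 (c l).2 := by
    rw [latticeVertex_succ, Prod.fst_add, Prod.snd_add, add_sub_cancel_left, add_sub_cancel_left,
      Int.gcd_natCast_natCast]
  have hcompact : IsCompact (pathPolygon c) := (Set.finite_range _).isCompact_convexHull ℝ
  have hpick := hchain.two_mul_ncard_preimage_toPlane_convexHull hk
  rw [toPlane_comp_latticeVertex, ← pathPolygon, ← interiorCount_add_boundaryCount hcompact,
    latticeVertex_zero, latticeVertex_last, hc.2.1, hc.2.2.1, cross_zero_right, add_zero,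
    Prod.fst_zero, Prod.snd_zero, sub_zero, sub_zero, Int.gcd_natCast_natCast] at hpick
  simp only [hgcd] at hpick
  rw [← sum_cross_latticeVertex]
  exact_mod_cast hpick

end Gons

theorem lemma1p3 (i j k : ℕ) (hi : 0 < i) (hj : 0 < j) (hk : 1 ≤ k) :
    Set.BijOn pathPolygon (slopeSequences i j k) (gonsInDelta i j (k + 1)) ∧
    ∀ c ∈ slopeSequences i j k,
      (1 / 2 : ℝ) *
          (∑ l₁, ∑ l₂ ∈ Finset.Ioi l₁,
              (((c l₁).1 : ℝ) * ((c l₂).2 : ℝ) - ((c l₂).1 : ℝ) * ((c l₁).2 : ℝ)) +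
            ∑ l, (Nat.gcd (c l).1 (c l).2 : ℝ)) =
        (interiorCount (pathPolygon c) : ℝ) + (boundaryCount (pathPolygon c) : ℝ) - 1 -
          (1 / 2 : ℝ) * (Nat.gcd i j : ℝ) := by
  refine ⟨⟨mapsTo_pathPolygon hi hk, injOn_pathPolygon, surjOn_pathPolygon hi hj⟩, fun c hc => ?_⟩
  have hpick := two_mul_interiorCount_add_boundaryCount hk hc
  linarith
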